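/- Let $A\ge 2$ be an integer. Let $T=(V,E')$ be the infinite rooted tree in which every node has exactly $A$ children, with nodes $V=\{(j,k): j\in\mathbb N,\ 1\le k\le A^j\}$, where $(j+1,A(k-1)+1),\dots,(j+1,Ak)$ are the children of $(j,k)$. Let $G=(V,E'\cup\tilde E)$ be a graph growing at the exponential rate $A$, that is, $\tilde E$ is a set of additional edges on $V$, disjoint from $E'$, with $\sup\{d_T(v,w): (v,w)\in\tilde E\}<\infty$. Here edges are undirected and $d_T,d_G$ denote the graph metrics of $T$ and $G$; moreover $d_G(I,J)=\inf\{d_G(v,w): v\in I,\ w\in J\}$ for $I,J\subseteq V$. Let $Z=\{Z_v: v\in V\}$ be real-valued random variables on a probability space with $\mathbb E Z_v=0$, $\|Z_v\|_\infty\le C$ and $\operatorname{Var}(Z_v)\le\sigma^2$ for all $v\in V$, where $0<\sigma,C<\infty$. For $n\in\mathbb N$ let $$\alpha_G(n)=\sup_{I,J\subseteq V,\ d_G(I,J)\ge n}\ \ \sup_{B\in\sigma(Z_v:v\in I),\ B'\in\sigma(Z_v:v\in J)}|\mathbb P(B\cap B')-\mathbb P(B)\mathbb P(B')|$$ and assume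 that $Z$ is strong mixing with respect to $G$, i.e. $\alpha_G(n)\to0$ as $n\to\infty$. For $P,k\ge1$ let $N(P,k)$ be the number of ordered pairs of nodes at distance exactly $k$ in the subtree formed by the first $P$ generations of $T$, i.e. $$N(P,k)=\sum_{h=0}^{\lfloor P-1-k/2\rfloor}A^h\sum_{i=\max(1,\,k-(P-1-h))}^{\min(k,\,P-1-h)}A^i\Big(2\cdot\mathbf 1_{\{k=i\}}+(A-1)A^{k-i-1}\mathbf 1_{\{k>i\}}\Big)$$ (an empty sum is $0$). Assume that the mixing coefficients satisfy $$\sum_{k\ge1}\alpha_G(k)\,N(P,k)=\mathcal O(PA^P)\qquad(P\to\infty),$$ or that they decay at a super-exponential rate, i.e. there is a positive increasing function $g$ with $\lim_{n\to\infty}g(n)=\infty$ and $\alpha_G(n)\le\exp(-n\,g(n))$ for all $n\in\mathbb N$. For $L\ge1$ let $V_L=\{(j,k)\in V: 0\le j\le L-1\}$ be the set of nodes in the first $L$ generations. Then there are constants $c_1,c_2>0$ such that for all integers $L\ge2$ and all $\epsilon>0$ $$\mathbb P\Big(\frac1{|V_L|}\Big|\sum_{v\in V_L}Z_v\Big|>\epsilon\Big)\le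 c_1\exp\Big\{-c_2\,\epsilon\,\frac{L}{\log L}\Big\}.$$ -/

import Mathlib

open Filter Topology MeasureTheory ProbabilityTheory

namespace ExpGraph

/-- The nodes `(j, k)` with `j ∈ ℕ` and `1 ≤ k ≤ A ^ j`: the `k`-th node of generation `j` in
the rooted tree in which every node has exactly `A` children. The root is `(0, 1)`. -/
abbrev Node (A : ℕ) : Type := {p : ℕ × ℕ // 1 ≤ p.2 ∧ p.2 ≤ A ^ p.1}

/-- The tree growing at exponential rate `A`, as an undirected graph: the children of `(j, k)` are
`(j + 1, k')` with `A (k - 1) + 1 ≤ k' ≤ A k`. -/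
def expTree (A : ℕ) : SimpleGraph (Node A) :=
  SimpleGraph.fromRel fun v w =>
    w.1.1 = v.1.1 + 1 ∧ A * (v.1.2 - 1) + 1 ≤ w.1.2 ∧ w.1.2 ≤ A * v.1.2

/-- `G` is a graph growing at exponential rate `A`: its edges are those of the tree together with
a disjoint set of additional edges whose tree length is bounded. -/
def IsExpGrowing (A : ℕ) (G : SimpleGraph (Node A)) : Prop :=
  ∃ X : SimpleGraph (Node A), Disjoint (expTree A) X ∧ G = expTree A ⊔ X ∧
    (⨆ (v : Node A) (w : Node A) (_ : X.Adj v w), (expTree A).edist v w) < ⊤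

/-- The first `L` generations `{(j, k) ∈ V : 0 ≤ j ≤ L - 1, 1 ≤ k ≤ A ^ (L - 1)}`. -/
def firstGenerations (A L : ℕ) : Finset (Node A) :=
  Finset.subtype _ (Finset.range L ×ˢ Finset.Icc 1 (A ^ (L - 1)))

/-- The graph distance between two sets of nodes (`⊤` if one of them is empty). -/
noncomputable def setDist {V : Type*} (G : SimpleGraph V) (I J : Set V) : ℕ∞ :=
  ⨅ v ∈ I, ⨅ w ∈ J, G.edist v w

/-- The sigma-algebra generated by the variables `Z v`, `v ∈ I`. -/
abbrev sigmaField {V Ω : Type*} (Z : V → Ω → ℝ) (I : Set V) : MeasurableSpace Ω :=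
  ⨆ v ∈ I, MeasurableSpace.comap (Z v) inferInstance

/-- The `α`-mixing coefficient of the random field `Z` with respect to the graph `G`. -/
noncomputable def alphaMixing {V Ω : Type*} [MeasurableSpace Ω] (μ : Measure Ω)
    (G : SimpleGraph V) (Z : V → Ω → ℝ) (n : ℕ) : ℝ :=
  sSup {x : ℝ | ∃ I J : Set V, (n : ℕ∞) ≤ setDist G I J ∧
    ∃ S T : Set Ω, MeasurableSet[sigmaField Z I] S ∧ MeasurableSet[sigmaField Z J] T ∧
      x = |μ.real (S ∩ T) - μ.real S * μ.real T|}

/-- `N(P, k)`: for `k ≥ 1`, the number of ordered pairs of nodes at distance exactly `k` in a tree of `P` generations in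
which each node that is not in the last generation has `A` children. In the sum, `h` is the
generation of the nearest common ancestor (so `h ≤ P - 1 - k / 2`) and `i` is the distance from
that ancestor to the first of the two nodes, the case `i = k` covering both orders of a pair of a
node and its descendant. The value is `0` for `k = 0` and for `k > 2 (P - 1)`. -/
def pairCount (A P k : ℕ) : ℕ :=
  ∑ h ∈ Finset.range P with 2 * h + k ≤ 2 * (P - 1),
    A ^ h * ∑ i ∈ Finset.Icc (max 1 (k - (P - 1 - h))) (min k (P - 1 - h)),
      A ^ i * ((if k = i then 2 else 0) + (if i < k then (A - 1) * A ^ (k - i - 1) else 0))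

/-- The condition `∑ₖ α(k) N(P, k) ∈ O(P A ^ P)` as `P → ∞`. For each `P` only finitely many
summands are nonzero. -/
def SummableMixing (A : ℕ) (α : ℕ → ℝ) : Prop :=
  (fun P : ℕ => ∑' k : ℕ, α k * (pairCount A P k : ℝ)) =O[atTop]
    fun P : ℕ => (P : ℝ) * (A : ℝ) ^ P

/-- Decay at a super-exponential rate. -/
def SuperExponentialDecay (α : ℕ → ℝ) : Prop :=
  ∃ g : ℕ → ℝ, (∀ n, 0 < g n) ∧ Monotone g ∧ Tendsto g atTop atTop ∧
    ∀ n : ℕ, α n ≤ Real.exp (-(n * g n))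

end ExpGraph

/-! Chebyshev's inequality suffices, because the sample mean has a second moment exponentially small
in `L`. Either decay hypothesis forces `α(2m) ≤ K r^m` (`exists_geometric_bound`), and `α` controls
covariances of bounded variables (`abs_integral_mul_le_alphaMixing`). Exponential growth makes most
pairs distant. With `h` a small multiple of `L`, nearly all nodes `v` lie far below generation `h`,
and few `w` share the ancestor of `v` at that generation. For every other `w`, a path from `v` must
climb out of the subtree of that ancestor; extra edges shorten it by at most a constant factor
(`le_edist_of_relDepth`). `sum_sum_le` adds up the three kinds of pairs. The factor `1/ε²` is
harmless: the claim is trivial unless `log L / L < ε < C`, and then `1/ε²` is at most quadratic in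
`L` (`exists_le_exp_of_le_geometric`). -/

namespace ExpGraph

/-! ### Covariance inequality from events to bounded variables -/

section Covariance

variable {Ω : Type*} [MeasurableSpace Ω] {μ : Measure Ω}

lemma intervalIntegral_ite_lt_eq {C z : ℝ} (hz : |z| ≤ C) (h : ℝ) :
    ∫ s in (-C)..C, (if s < z then h else 0) = (z + C) * h := by
  obtain ⟨h1, h2⟩ := abs_le.1 hz
  have hset : Set.Ioc (-C) C ∩ Set.Iio z = Set.Ioo (-C) z := by
    ext s
    simp only [Set.mem_inter_iff, Set.mem_Ioc, Set.mem_Iio, Set.mem_Ioo]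
    constructor
    · rintro ⟨⟨a, -⟩, b⟩
      exact ⟨a, b⟩
    · rintro ⟨a, b⟩
      exact ⟨⟨a, by linarith⟩, b⟩
  have hind : (fun s : ℝ => if s < z then h else 0) = (Set.Iio z).indicator fun _ => h := by
    ext s
    simp [Set.indicator_apply]
  rw [intervalIntegral.integral_of_le (by linarith), hind, setIntegral_indicator measurableSet_Iio,
    hset, setIntegral_const, Real.volume_real_Ioo_of_le h1]
  simp

/-- A bounded factor can be replaced by the indicators of its superlevel sets. -/
lemma abs_integral_mul_le_of_superlevel [IsProbabilityMeasure μ] {Z h : Ω → ℝ} {C κ : ℝ}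
    (hZ : Measurable Z) (hC : 0 ≤ C) (hZC : ∀ᵐ ω ∂μ, |Z ω| ≤ C) (hh : Integrable h μ)
    (hh0 : ∫ ω, h ω ∂μ = 0) (hκ : ∀ s, |∫ ω in {ω | s < Z ω}, h ω ∂μ| ≤ κ) :
    |∫ ω, Z ω * h ω ∂μ| ≤ 2 * C * κ := by
  have hmeas (s : ℝ) : MeasurableSet {ω | s < Z ω} := measurableSet_lt measurable_const hZ
  -- Layer cake and Fubini: `Z + C` is the integral of `1_{s < Z}` over `s ∈ (-C, C]`. The shift by
  -- `C` disappears because `h` has mean zero.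
  have hswap := intervalIntegral_integral_swap (μ := μ) (a := -C) (b := C)
    (f := fun s ω => if s < Z ω then h ω else 0) (by
      have hS : MeasurableSet {p : ℝ × Ω | p.1 < Z p.2} :=
        measurableSet_lt measurable_fst (hZ.comp measurable_snd)
      have : IsFiniteMeasure ((volume : Measure ℝ).restrict (Set.uIoc (-C) C)) :=
        ⟨by simp [Set.uIoc]⟩
      have hi := (hh.comp_snd ((volume : Measure ℝ).restrict (Set.uIoc (-C) C))).indicator hS
      refine hi.congr (ae_of_all _ ?_)
      rintro ⟨s, ω⟩
      simp [Function.uncurry, Set.indicator_apply])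
  have hleft (s : ℝ) : ∫ ω, (if s < Z ω then h ω else 0) ∂μ = ∫ ω in {ω | s < Z ω}, h ω ∂μ := by
    rw [← integral_indicator (hmeas s)]
    simp only [Set.indicator_apply, Set.mem_ofPred_eq]
  have hZh : Integrable (fun ω => Z ω * h ω) μ :=
    hh.bdd_mul hZ.aestronglyMeasurable (by simpa using hZC)
  have hright : ∫ ω, (∫ s in (-C)..C, if s < Z ω then h ω else 0) ∂μ = ∫ ω, Z ω * h ω ∂μ := by
    calc _ = ∫ ω, (Z ω * h ω + C * h ω) ∂μ := by
          refine integral_congr_ae ?_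
          filter_upwards [hZC] with ω hω
          rw [intervalIntegral_ite_lt_eq hω]
          ring
      _ = _ := by
          rw [integral_add hZh (hh.const_mul C), integral_const_mul, hh0]
          simp
  rw [← hright, ← hswap]
  simp_rw [hleft]
  have := intervalIntegral.norm_integral_le_of_norm_le_const (a := -C) (b := C) (C := κ)
    (f := fun s => ∫ ω in {ω | s < Z ω}, h ω ∂μ) (fun s _ => hκ s)
  rw [Real.norm_eq_abs, abs_of_nonneg (by linarith : (0 : ℝ) ≤ C - -C)] at this
  linarith

/-- The covariance inequality for bounded variables. -/
lemma abs_integral_mul_le_of_events [IsProbabilityMeasure μ] {X Y : Ω → ℝ} {C κ : ℝ}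
    (hX : Measurable X) (hY : Measurable Y) (hC : 0 ≤ C) (hXC : ∀ᵐ ω ∂μ, |X ω| ≤ C)
    (hYC : ∀ᵐ ω ∂μ, |Y ω| ≤ C) (hY0 : ∫ ω, Y ω ∂μ = 0)
    (hκ : ∀ s t, |μ.real ({ω | s < X ω} ∩ {ω | t < Y ω}) -
      μ.real {ω | s < X ω} * μ.real {ω | t < Y ω}| ≤ κ) :
    |∫ ω, X ω * Y ω ∂μ| ≤ 4 * C ^ 2 * κ := by
  have hYi : Integrable Y μ :=
    (memLp_top_of_bound hY.aestronglyMeasurable C (by simpa using hYC)).integrable le_top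
  have key (s : ℝ) : |∫ ω in {ω | s < X ω}, Y ω ∂μ| ≤ 2 * C * κ := by
    set S : Set Ω := {ω | s < X ω} with hSdef
    have hS : MeasurableSet S := measurableSet_lt measurable_const hX
    have hSi : Integrable (S.indicator (fun _ => (1 : ℝ))) μ := (integrable_const 1).indicator hS
    have hci : Integrable (fun _ : Ω => μ.real S) μ := integrable_const _
    -- The centred indicator of `S` turns integrals over `{t < Y}` into covariances of events. Layer
    -- cake in `Y`, then in `X`, costs `2C` each time.
    have h := abs_integral_mul_le_of_superlevel (μ := μ) (Z := Y)
      (h := fun ω => S.indicator (fun _ => (1 : ℝ)) ω - μ.real S) (κ := κ) hY hC hYC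
      (hSi.sub hci) (by
        rw [integral_sub hSi hci, integral_indicator_const _ hS]
        simp) (fun t => by
        have hT : MeasurableSet {ω | t < Y ω} := measurableSet_lt measurable_const hY
        rw [integral_sub hSi.integrableOn hci.integrableOn, setIntegral_indicator hS]
        simp only [setIntegral_const, smul_eq_mul, mul_one]
        rw [Set.inter_comm, mul_comm]
        exact hκ s t)
    have heq : ∫ ω, Y ω * (S.indicator (fun _ => (1 : ℝ)) ω - μ.real S) ∂μ = ∫ ω in S, Y ω ∂μ := by
      have e (ω : Ω) : Y ω * (S.indicator (fun _ => (1 : ℝ)) ω - μ.real S) =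
          S.indicator Y ω - Y ω * μ.real S := by
        by_cases hω : ω ∈ S <;> simp [hω, mul_sub]
      simp_rw [e]
      rw [integral_sub (hYi.indicator hS) (hYi.mul_const _), integral_indicator hS,
        integral_mul_const, hY0]
      simp
    rwa [heq] at h
  have := abs_integral_mul_le_of_superlevel hX hC hXC hYi hY0 key
  linarith

end Covariance

/-! ### Mixing coefficients -/

section Mixing

variable {V Ω : Type*} [MeasurableSpace Ω] {μ : Measure Ω} {G : SimpleGraph V} {Z : V → Ω → ℝ}

lemma alphaMixing_nonneg (n : ℕ) : 0 ≤ alphaMixing μ G Z n := by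
  refine Real.sSup_nonneg ?_
  rintro x ⟨_, _, _, S, T, _, _, rfl⟩
  exact abs_nonneg _

variable [IsProbabilityMeasure μ]

lemma abs_real_inter_sub_mul_le_one (S T : Set Ω) :
    |μ.real (S ∩ T) - μ.real S * μ.real T| ≤ 1 := by
  have h1 : μ.real (S ∩ T) ≤ 1 := measureReal_le_one
  have h2 : μ.real S ≤ 1 := measureReal_le_one
  have h3 : μ.real T ≤ 1 := measureReal_le_one
  have h4 : 0 ≤ μ.real (S ∩ T) := measureReal_nonneg
  have h5 : 0 ≤ μ.real S * μ.real T := mul_nonneg measureReal_nonneg measureReal_nonneg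
  have h6 : μ.real S * μ.real T ≤ 1 := mul_le_one₀ h2 measureReal_nonneg h3
  rw [abs_le]
  constructor <;> linarith

lemma le_alphaMixing {n : ℕ} {I J : Set V} (hIJ : (n : ℕ∞) ≤ setDist G I J) {S T : Set Ω}
    (hS : MeasurableSet[sigmaField Z I] S) (hT : MeasurableSet[sigmaField Z J] T) :
    |μ.real (S ∩ T) - μ.real S * μ.real T| ≤ alphaMixing μ G Z n := by
  refine le_csSup ⟨1, ?_⟩ ⟨I, J, hIJ, S, T, hS, hT, rfl⟩
  rintro x ⟨_, _, _, S, T, _, _, rfl⟩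
  exact abs_real_inter_sub_mul_le_one S T

lemma alphaMixing_le_one (n : ℕ) : alphaMixing μ G Z n ≤ 1 := by
  refine Real.sSup_le ?_ zero_le_one
  rintro x ⟨_, _, _, S, T, _, _, rfl⟩
  exact abs_real_inter_sub_mul_le_one S T

lemma abs_integral_mul_le_alphaMixing (hZ : ∀ v, Measurable (Z v)) {C : ℝ} (hC : 0 ≤ C)
    (hZC : ∀ v, ∀ᵐ ω ∂μ, |Z v ω| ≤ C) (hmean : ∀ v, ∫ ω, Z v ω ∂μ = 0) {n : ℕ} {v w : V}
    (hvw : (n : ℕ∞) ≤ G.edist v w) :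
    |∫ ω, Z v ω * Z w ω ∂μ| ≤ 4 * C ^ 2 * alphaMixing μ G Z n := by
  have hlt (u : V) (s : ℝ) : MeasurableSet[sigmaField Z {u}] {ω | s < Z u ω} := by
    have : MeasurableSpace.comap (Z u) inferInstance ≤ sigmaField Z {u} :=
      le_iSup₂_of_le u (Set.mem_singleton u) le_rfl
    exact this _ ⟨Set.Ioi s, measurableSet_Ioi, rfl⟩
  refine abs_integral_mul_le_of_events (hZ v) (hZ w) hC (hZC v) (hZC w) (hmean w) fun s t => ?_
  exact le_alphaMixing (G := G) (I := {v}) (J := {w}) (by simpa [setDist] using hvw)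
    (hlt v s) (hlt w t)

end Mixing

/-! ### Geometric decay of the mixing coefficients -/

section Rate

/-- Both decay conditions force exponential decay. -/
lemma exists_geometric_bound {A : ℕ} (hA : 2 ≤ A) {α : ℕ → ℝ} (h0 : ∀ n, 0 ≤ α n)
    (h1 : ∀ n, α n ≤ 1) (h : SummableMixing A α ∨ SuperExponentialDecay α) :
    ∃ K r : ℝ, 0 < K ∧ 0 < r ∧ r < 1 ∧ ∀ m, α (2 * m) ≤ K * r ^ m := by
  rcases h with h | ⟨g, hg, hmono, -, hle⟩
  · obtain ⟨c, hc0, hc⟩ := h.exists_pos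
    obtain ⟨M, hM⟩ := eventually_atTop.1 hc.bound
    have hA1 : (2 : ℝ) ≤ A := by exact_mod_cast hA
    have hApos : (0 : ℝ) < A := by linarith
    have hvanish (P k : ℕ) (hk : 2 * (P - 1) < k) : pairCount A P k = 0 := by
      unfold pairCount
      rw [Finset.filter_eq_empty_iff.2 (by intro i _; omega), Finset.sum_empty]
    -- Keep only the pairs of leaves whose nearest common ancestor is the root: `A^m (A-1) A^(m-1)`
    -- of them.
    have hcount (m : ℕ) (hm : 1 ≤ m) : A ^ (2 * m - 1) ≤ pairCount A (m + 1) (2 * m) := by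
      unfold pairCount
      refine le_trans ?_ (Finset.single_le_sum (fun _ _ => Nat.zero_le _)
        (a := 0) (by simp))
      refine le_trans ?_ (Nat.mul_le_mul_left _ (Finset.single_le_sum (fun _ _ => Nat.zero_le _)
        (a := m) (by simp; omega)))
      rw [if_pos (show m < 2 * m by omega), if_neg (show 2 * m ≠ m by omega), pow_zero, one_mul,
        zero_add, show 2 * m - 1 = m + (m - 1) by omega, show 2 * m - m - 1 = m - 1 by omega,
        pow_add]
      exact Nat.mul_le_mul_left _ (Nat.le_mul_of_pos_left _ (by omega))
    have hlarge (m : ℕ) (hm1 : 1 ≤ m) (hm : M ≤ m) : α (2 * m) ≤ 2 * c * A ^ 2 * (3 / 4) ^ m := by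
      have hb := hM (m + 1) (by omega)
      have hsum : Summable fun k : ℕ => α k * (pairCount A (m + 1) k : ℝ) := by
        refine summable_of_ne_finset_zero (s := Finset.range (2 * m + 1)) fun k hk => ?_
        rw [hvanish _ _ (by simp at hk; omega)]
        simp
      have hterm := hsum.le_tsum (2 * m) fun k _ => mul_nonneg (h0 k) (Nat.cast_nonneg _)
      have hN : (A : ℝ) ^ (2 * m - 1) ≤ pairCount A (m + 1) (2 * m) := by
        exact_mod_cast hcount m hm1
      have h2 := mul_le_mul_of_nonneg_left hN (h0 (2 * m))
      have h3 : α (2 * m) * (A : ℝ) ^ (2 * m - 1) ≤ c * ((m + 1) * (A : ℝ) ^ (m + 1)) := by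
        refine (h2.trans hterm).trans ((le_abs_self _).trans (hb.trans_eq ?_))
        rw [Real.norm_of_nonneg (by positivity)]
        push_cast
        ring
      have h4 : α (2 * m) * (A : ℝ) ^ m ≤ c * (m + 1) * A ^ 2 := by
        have e1 : (A : ℝ) ^ (2 * m - 1) * A = A ^ m * A ^ m := by
          rw [← pow_succ, ← pow_add]
          congr 1
          omega
        have := mul_le_mul_of_nonneg_right h3 hApos.le
        rw [mul_assoc, e1] at this
        have hAm : (0 : ℝ) < (A : ℝ) ^ m := by positivity
        refine le_of_mul_le_mul_right ?_ hAm
        calc _ = α (2 * m) * ((A : ℝ) ^ m * A ^ m) := by ring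
          _ ≤ _ := this
          _ = _ := by ring
      -- Bernoulli absorbs the linear factor; against `A^m ≥ 2^m` the ratio `3/4` remains.
      have h5 : ((m : ℝ) + 1) ≤ 2 * (3 / 2) ^ m := by
        have := one_add_mul_le_pow (a := (1 / 2 : ℝ)) (by norm_num) m
        norm_num at this
        linarith
      have h6 : (2 : ℝ) ^ m ≤ A ^ m := pow_le_pow_left₀ (by norm_num) hA1 m
      have h7 : α (2 * m) * 2 ^ m ≤ c * (2 * (3 / 2) ^ m) * A ^ 2 :=
        (mul_le_mul_of_nonneg_left h6 (h0 _)).trans (h4.trans (by gcongr))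
      refine le_of_mul_le_mul_right (h7.trans_eq ?_) (show (0 : ℝ) < 2 ^ m by positivity)
      rw [show (3 / 2 : ℝ) = 3 / 4 * 2 by norm_num, mul_pow]
      ring
    -- The second summand covers `m ≤ M`, where only `α ≤ 1` is available.
    refine ⟨2 * c * A ^ 2 + (4 / 3) ^ (M + 1), 3 / 4, by positivity, by norm_num, by norm_num,
      fun m => ?_⟩
    by_cases hm : M + 1 ≤ m
    · refine (hlarge m (by omega) (by omega)).trans ?_
      gcongr
      exact le_add_of_nonneg_right (by positivity)
    · refine (h1 _).trans ?_
      have h8 : (1 : ℝ) = (4 / 3) ^ m * (3 / 4) ^ m := by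
        rw [← mul_pow]
        norm_num
      have h9 : (4 / 3 : ℝ) ^ m ≤ (4 / 3) ^ (M + 1) :=
        pow_le_pow_right₀ (by norm_num) (by omega)
      rw [h8]
      gcongr
      exact h9.trans (le_add_of_nonneg_left (by positivity))
  · refine ⟨1, Real.exp (-g 0), one_pos, Real.exp_pos _, by simpa using hg 0, fun m => ?_⟩
    refine (hle _).trans ?_
    rw [one_mul, ← Real.exp_nat_mul, Real.exp_le_exp]
    have h2 : g 0 ≤ g (2 * m) := hmono (Nat.zero_le _)
    have h3 : (0 : ℝ) ≤ m := Nat.cast_nonneg _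
    have h4 := hg 0
    push_cast
    nlinarith [mul_le_mul_of_nonneg_left h2 h3, mul_nonneg h3 (h4.le.trans h2)]

end Rate

end ExpGraph

namespace ExpGraph

/-! ### Tree geometry: depth below an ancestor, and node counts -/

section Geometry

variable {A : ℕ}

/-- The depth of `u` below the `a`-th node of generation `h`, and `0` for a node which does not
descend from it. -/
def relDepth (h a : ℕ) (u : Node A) : ℕ :=
  if (u.1.2 - 1) / A ^ (u.1.1 - h) = a then u.1.1 - h else 0

lemma relDepth_child (hA : 2 ≤ A) (h a : ℕ) {v w : Node A} (h1 : w.1.1 = v.1.1 + 1)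
    (h2 : A * (v.1.2 - 1) + 1 ≤ w.1.2) (h3 : w.1.2 ≤ A * v.1.2) :
    relDepth h a v ≤ relDepth h a w + 1 ∧ relDepth h a w ≤ relDepth h a v + 1 := by
  have hdiv : (w.1.2 - 1) / A = v.1.2 - 1 := by
    have hv := v.2.1
    obtain ⟨k, hk⟩ : ∃ k, v.1.2 = k + 1 := ⟨v.1.2 - 1, by omega⟩
    rw [hk] at h2 h3 ⊢
    rw [Nat.add_sub_cancel] at h2 ⊢
    rw [Nat.div_eq_iff (by omega)]
    constructor
    · rw [mul_comm]
      omega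
    · have : A * (k + 1) = k * A + A := by ring
      omega
  unfold relDepth
  by_cases hh : h ≤ v.1.1
  · have e : (w.1.2 - 1) / A ^ (w.1.1 - h) = (v.1.2 - 1) / A ^ (v.1.1 - h) := by
      rw [show w.1.1 - h = (v.1.1 - h) + 1 by omega, pow_succ', ← Nat.div_div_eq_div_mul, hdiv]
    rw [e]
    split_ifs <;> omega
  -- Here the child is at generation at most `h`, so truncated subtraction makes both depths `0`.
  · have hw : w.1.1 - h = 0 := by omega
    have hv : v.1.1 - h = 0 := by omega
    rw [hw, hv]
    simp

lemma relDepth_le_of_adj (hA : 2 ≤ A) (h a : ℕ) {v w : Node A} (hvw : (expTree A).Adj v w) :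
    relDepth h a v ≤ relDepth h a w + 1 := by
  rw [expTree, SimpleGraph.fromRel_adj] at hvw
  rcases hvw.2 with ⟨h1, h2, h3⟩ | ⟨h1, h2, h3⟩
  · exact (relDepth_child hA h a h1 h2 h3).1
  · exact (relDepth_child hA h a h1 h2 h3).2

lemma le_add_mul_length_of_adj {V : Type*} {G : SimpleGraph V} {f : V → ℕ} {D : ℕ}
    (hf : ∀ v w, G.Adj v w → f v ≤ f w + D) {v w : V} (p : G.Walk v w) :
    f v ≤ f w + D * p.length := by
  induction p with
  | nil => simp
  | cons hadj p ih =>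
    refine (hf _ _ hadj).trans ?_
    rw [SimpleGraph.Walk.length_cons, mul_add, mul_one]
    omega

/-- A tree edge changes the depth by at most one, and an additional edge is replaced by a tree path
of bounded length. -/
lemma exists_relDepth_le (hA : 2 ≤ A) {G : SimpleGraph (Node A)} (hG : IsExpGrowing A G) :
    ∃ D : ℕ, 1 ≤ D ∧ ∀ h a v w, G.Adj v w → relDepth h a v ≤ relDepth h a w + D := by
  obtain ⟨X, -, rfl, hX⟩ := hG
  obtain ⟨D, hD⟩ := ENat.ne_top_iff_exists.1 hX.ne
  refine ⟨D + 1, by omega, fun h a v w hvw => ?_⟩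
  rcases hvw with hvw | hvw
  · exact (relDepth_le_of_adj hA h a hvw).trans (by omega)
  · have hle : (expTree A).edist v w ≤ D := by
      rw [hD]
      exact le_iSup_of_le v (le_iSup_of_le w (le_iSup_of_le hvw le_rfl))
    obtain ⟨p, hp⟩ := SimpleGraph.exists_walk_of_edist_ne_top
      (ne_top_of_le_ne_top (ENat.natCast_ne_top D) hle)
    rw [← hp] at hle
    have hlen : p.length ≤ D := by exact_mod_cast hle
    have := le_add_mul_length_of_adj (fun v w => relDepth_le_of_adj hA h a) p
    omega

/-- The depth drops by at most `D` per edge, so fewer than `n` edges cannot bring it from `D * n` to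
`0`. -/
lemma le_edist_of_relDepth {G : SimpleGraph (Node A)} {D : ℕ} (hD : 1 ≤ D)
    (hG : ∀ h a v w, G.Adj v w → relDepth h a v ≤ relDepth h a w + D) {h a n : ℕ} {v w : Node A}
    (hv : D * n ≤ relDepth h a v) (hw : relDepth h a w = 0) : (n : ℕ∞) ≤ G.edist v w := by
  by_contra! hlt
  obtain ⟨p, hp⟩ := SimpleGraph.exists_walk_of_edist_ne_top (hlt.trans_le le_top).ne
  rw [← hp] at hlt
  have hlen : p.length < n := by exact_mod_cast hlt
  have h1 := le_add_mul_length_of_adj (hG h a) p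
  have h2 := Nat.mul_lt_mul_of_pos_left hlen hD
  omega

lemma mem_firstGenerations {L : ℕ} (hA : 2 ≤ A) {v : Node A} :
    v ∈ firstGenerations A L ↔ v.1.1 < L := by
  simp only [firstGenerations, Finset.mem_subtype, Finset.mem_product, Finset.mem_range,
    Finset.mem_Icc]
  refine ⟨fun h => h.1, fun h => ⟨h, v.2.1, v.2.2.trans ?_⟩⟩
  exact Nat.pow_le_pow_right (by omega) (by omega)

/-- A descendant is determined by its depth and its position in its block; the geometric sum of the
block sizes `A^i`, `i < L - h`, is below `A^(L-h)`. -/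
lemma card_descendants_le (hA : 2 ≤ A) (L h a : ℕ) :
    ((firstGenerations A L).filter fun u : Node A =>
      h ≤ u.1.1 ∧ (u.1.2 - 1) / A ^ (u.1.1 - h) = a).card ≤ A ^ (L - h) := by
  have hcard : ((Finset.range (L - h)).sigma fun i => Finset.range (A ^ i)).card ≤ A ^ (L - h) := by
    rw [Finset.card_sigma]
    simp only [Finset.card_range]
    exact (Nat.geomSum_lt hA (by simp)).le
  refine le_trans (Finset.card_le_card_of_injOn
    (fun u => (⟨u.1.1 - h, (u.1.2 - 1) % A ^ (u.1.1 - h)⟩ : Σ _ : ℕ, ℕ)) ?_ ?_) hcard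
  · intro u hu
    simp only [Finset.coe_filter, Set.mem_ofPred_eq, mem_firstGenerations hA] at hu
    simp only [Finset.coe_sigma, Set.mem_sigma_iff, Finset.coe_range, Set.mem_Iio]
    exact ⟨by omega, Nat.mod_lt _ (by positivity)⟩
  · rintro ⟨⟨j, k⟩, hk⟩ hu ⟨⟨j', k'⟩, hk'⟩ hu' heq
    simp only [Finset.coe_filter, Set.mem_ofPred_eq] at hu hu'
    simp only [Sigma.mk.injEq, heq_eq_eq] at heq
    obtain ⟨-, hj, hd⟩ := hu
    obtain ⟨-, hj', hd'⟩ := hu'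
    have hjj : j = j' := by omega
    subst hjj
    have e := Nat.div_add_mod (k - 1) (A ^ (j - h))
    have e' := Nat.div_add_mod (k' - 1) (A ^ (j - h))
    rw [hd, heq.2] at e
    rw [hd'] at e'
    simp only at hk hk'
    have : k = k' := by omega
    subst this
    rfl

lemma card_firstGenerations_le (hA : 2 ≤ A) (L : ℕ) : (firstGenerations A L).card ≤ A ^ L := by
  refine le_trans (le_of_eq ?_) (card_descendants_le hA L 0 0)
  rw [Finset.filter_true_of_mem]
  rintro ⟨⟨j, k⟩, hk⟩ -
  simp only at hk
  exact ⟨Nat.zero_le _, Nat.div_eq_of_lt (by simp only [Nat.sub_zero]; omega)⟩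

lemma le_card_firstGenerations (hA : 2 ≤ A) {L : ℕ} (hL : 1 ≤ L) :
    A ^ (L - 1) ≤ (firstGenerations A L).card := by
  classical
  have hpos : 0 < A ^ (L - 1) := by positivity
  have hle (k : ℕ) (hk : k < A ^ (L - 1)) : 1 ≤ (L - 1, k + 1).2 ∧
      (L - 1, k + 1).2 ≤ A ^ (L - 1, k + 1).1 := ⟨by simp, hk⟩
  have := Finset.card_le_card_of_injOn (s := Finset.univ) (t := firstGenerations A L)
    (fun k : Fin (A ^ (L - 1)) => (⟨(L - 1, k.1 + 1), hle k.1 k.2⟩ : Node A))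
    (fun k _ => by
      simp only [Finset.mem_coe, mem_firstGenerations hA]
      omega)
    (fun k _ k' _ hkk => by
      simp only [Subtype.mk.injEq, Prod.mk.injEq] at hkk
      exact Fin.ext (by omega))
  simpa using this

end Geometry

/-! ### Double sums over pairs of nodes -/

section Counting

/-- A double sum over the first `L` generations, the off-diagonal terms being small. -/
lemma sum_sum_le {A : ℕ} (hA : 2 ≤ A) {f : Node A → Node A → ℝ} {b δ : ℝ} (hb0 : 0 ≤ b)
    (hδ : 0 ≤ δ) (hb : ∀ v w, f v w ≤ b) {L h q : ℕ}
    (hf : ∀ (v w : Node A) (a : ℕ), q ≤ relDepth h a v → relDepth h a w = 0 → f v w ≤ δ) :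
    ∑ v ∈ firstGenerations A L, ∑ w ∈ firstGenerations A L, f v w ≤
      ((firstGenerations A L).card : ℝ) * (A ^ (h + q) * b + A ^ (L - h) * b +
        (firstGenerations A L).card * δ) := by
  set S := firstGenerations A L with hS
  have hrow (v : Node A) : ∑ w ∈ S, f v w ≤
      (if v.1.1 < h + q then (S.card : ℝ) * b else 0) + (A ^ (L - h) * b + S.card * δ) := by
    split_ifs with hv
    · have : ∑ w ∈ S, f v w ≤ S.card * b := by
        refine (Finset.sum_le_card_nsmul S _ b fun w _ => hb v w).trans_eq (by simp)
      have : (0 : ℝ) ≤ A ^ (L - h) * b + S.card * δ := by positivity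
      linarith
    -- `a` indexes the ancestor of `v` at generation `h`. Its descendants get the trivial bound `b`;
    -- all other `w` have relative depth `0` and get `δ`.
    · set a := (v.1.2 - 1) / A ^ (v.1.1 - h) with ha
      set p : Node A → Prop := fun u => h ≤ u.1.1 ∧ (u.1.2 - 1) / A ^ (u.1.1 - h) = a with hp
      have hcard : ((S.filter p).card : ℝ) ≤ A ^ (L - h) := by
        exact_mod_cast card_descendants_le hA L h a
      have hvd : q ≤ relDepth h a v := by
        rw [relDepth, if_pos rfl]
        omega
      rw [← Finset.sum_filter_add_sum_filter_not S p, zero_add]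
      refine add_le_add ?_ ?_
      · refine (Finset.sum_le_card_nsmul _ _ b fun w _ => hb v w).trans ?_
        rw [nsmul_eq_mul]
        gcongr
      · refine (Finset.sum_le_card_nsmul _ _ δ fun w hw => hf v w a hvd ?_).trans ?_
        · have hw' := (Finset.mem_filter.1 hw).2
          simp only [hp, not_and] at hw'
          rw [relDepth]
          split_ifs with hwa
          · by_contra hne
            exact hw' (by omega) hwa
          · rfl
        · rw [nsmul_eq_mul]
          gcongr
          exact Finset.filter_subset _ _
  have htop : ((S.filter fun v => v.1.1 < h + q).card : ℝ) ≤ A ^ (h + q) := by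
    have hsub : (S.filter fun v => v.1.1 < h + q) ⊆ firstGenerations A (h + q) := fun v hv =>
      (mem_firstGenerations hA).2 (Finset.mem_filter.1 hv).2
    exact_mod_cast (Finset.card_le_card hsub).trans (card_firstGenerations_le hA _)
  calc _ ≤ ∑ v ∈ S, ((if v.1.1 < h + q then (S.card : ℝ) * b else 0) +
        (A ^ (L - h) * b + S.card * δ)) := Finset.sum_le_sum fun v _ => hrow v
    _ = (S.filter fun v => v.1.1 < h + q).card * ((S.card : ℝ) * b) +
        S.card * (A ^ (L - h) * b + S.card * δ) := by
      rw [Finset.sum_add_distrib, ← Finset.sum_filter, Finset.sum_const, Finset.sum_const,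
        nsmul_eq_mul, nsmul_eq_mul]
    _ ≤ A ^ (h + q) * ((S.card : ℝ) * b) + S.card * (A ^ (L - h) * b + S.card * δ) := by gcongr
    _ = _ := by ring

end Counting

end ExpGraph

/-! ### Second moment bound and comparison of rates -/

namespace ExpGraph

/-- The sample mean over the first `L` generations has exponentially small second moment. -/
lemma exists_integral_sum_sq_le {Ω : Type*} [MeasurableSpace Ω] {μ : Measure Ω}
    [IsProbabilityMeasure μ] {A : ℕ} (hA : 2 ≤ A) {G : SimpleGraph (Node A)}
    (hG : IsExpGrowing A G) {Z : Node A → Ω → ℝ} (hZ : ∀ v, Measurable (Z v))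
    (hmean : ∀ v, ∫ ω, Z v ω ∂μ = 0) {C : ℝ} (hC : 0 < C)
    (hZC : ∀ v, ∀ᵐ ω ∂μ, |Z v ω| ≤ C)
    (hmix : SummableMixing A (alphaMixing μ G Z) ∨ SuperExponentialDecay (alphaMixing μ G Z)) :
    ∃ (K r : ℝ) (M : ℕ), 0 < K ∧ 0 < r ∧ r < 1 ∧ 0 < M ∧ ∀ L, 1 ≤ L →
      ∫ ω, (∑ v ∈ firstGenerations A L, Z v ω) ^ 2 ∂μ ≤
        ((firstGenerations A L).card : ℝ) ^ 2 * (K * r ^ (L / M)) := by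
  obtain ⟨D, hD1, hD⟩ := exists_relDepth_le hA hG
  obtain ⟨K, r, hK, hr0, hr1, hKr⟩ :=
    exists_geometric_bound hA (alphaMixing_nonneg (μ := μ) (G := G) (Z := Z))
      alphaMixing_le_one hmix
  -- With `h = q = 2Dm` and `m = L / (6D)`, both `h + q + m` and `L - h + m` are at most `L`, so
  -- shallow rows and common descendants each gain a factor `A^(-m)`. The maximum with `1/2` makes
  -- the rate dominate `1/A` as well as `r`.
  refine ⟨2 * A * C ^ 2 + 4 * C ^ 2 * K, max r (1 / 2), 6 * D, by positivity,
    lt_max_of_lt_left hr0, max_lt hr1 (by norm_num), by omega, fun L hL => ?_⟩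
  set S := firstGenerations A L with hS
  set m := L / (6 * D) with hm
  have hmem (v : Node A) : MemLp (Z v) ⊤ μ :=
    memLp_top_of_bound (hZ v).aestronglyMeasurable C (by simpa using hZC v)
  have hint (v w : Node A) : Integrable (fun ω => Z v ω * Z w ω) μ :=
    ((hmem w).integrable le_top).bdd_mul (hZ v).aestronglyMeasurable (by simpa using hZC v)
  have hexp : ∫ ω, (∑ v ∈ S, Z v ω) ^ 2 ∂μ = ∑ v ∈ S, ∑ w ∈ S, ∫ ω, Z v ω * Z w ω ∂μ := by
    simp_rw [sq, Finset.sum_mul_sum]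
    rw [integral_finsetSum _ fun v _ => integrable_finsetSum _ fun w _ => hint v w]
    exact Finset.sum_congr rfl fun v _ => integral_finsetSum _ fun w _ => hint v w
  have hb (v w : Node A) : ∫ ω, Z v ω * Z w ω ∂μ ≤ C ^ 2 := by
    calc _ ≤ ∫ _, C ^ 2 ∂μ := by
          refine integral_mono_ae (hint v w) (integrable_const _) ?_
          filter_upwards [hZC v, hZC w] with ω h1 h2
          calc Z v ω * Z w ω ≤ |Z v ω| * |Z w ω| := (le_abs_self _).trans_eq (abs_mul _ _)
            _ ≤ C * C := by gcongr
            _ = C ^ 2 := by ring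
      _ = C ^ 2 := by simp
  have hmain := sum_sum_le hA (f := fun v w => ∫ ω, Z v ω * Z w ω ∂μ) (b := C ^ 2)
    (δ := 4 * C ^ 2 * alphaMixing μ G Z (2 * m)) (L := L) (h := D * (2 * m)) (q := D * (2 * m))
    (by positivity) (mul_nonneg (by positivity) (alphaMixing_nonneg _)) hb
    (fun v w a hv hw => (le_abs_self _).trans
      (abs_integral_mul_le_alphaMixing hZ hC.le hZC hmean (le_edist_of_relDepth hD1 hD hv hw)))
  rw [hexp]
  refine hmain.trans ?_
  have hA0 : (0 : ℝ) < A := by positivity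
  have hA2 : (2 : ℝ) ≤ A := by exact_mod_cast hA
  have hN : (A : ℝ) ^ L ≤ A * S.card := by
    have : A ^ (L - 1) ≤ S.card := le_card_firstGenerations hA hL
    calc (A : ℝ) ^ L = A * A ^ (L - 1) := by
          rw [← pow_succ']
          congr 1
          omega
      _ ≤ A * S.card := by gcongr; exact_mod_cast this
  have hpow (e : ℕ) (he : e + m ≤ L) : (A : ℝ) ^ e ≤ A * S.card * max r (1 / 2) ^ m := by
    have h1 : (A : ℝ) ^ e * A ^ m ≤ A * S.card := by
      rw [← pow_add]
      exact (pow_le_pow_right₀ (by linarith) he).trans hN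
    have h2 : (1 : ℝ) ≤ A ^ m * max r (1 / 2) ^ m := by
      rw [← mul_pow]
      refine one_le_pow₀ ?_
      have : (1 / 2 : ℝ) ≤ max r (1 / 2) := le_max_right _ _
      nlinarith
    calc (A : ℝ) ^ e ≤ A ^ e * (A ^ m * max r (1 / 2) ^ m) := le_mul_of_one_le_right (by positivity) h2
      _ = A ^ e * A ^ m * max r (1 / 2) ^ m := by ring
      _ ≤ _ := by gcongr
  have hmD : m ≤ D * m := Nat.le_mul_of_pos_left _ hD1
  have hmL : 6 * (D * m) ≤ L := by
    have := Nat.mul_div_le L (6 * D)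
    rwa [← hm, mul_assoc] at this
  have e1 : D * (2 * m) = 2 * (D * m) := by ring
  have p1 := hpow (D * (2 * m) + D * (2 * m)) (by omega)
  have p2 := hpow (L - D * (2 * m)) (by omega)
  have p3 : alphaMixing μ G Z (2 * m) ≤ K * max r (1 / 2) ^ m :=
    (hKr m).trans (by gcongr; exact le_max_left _ _)
  calc _ ≤ (S.card : ℝ) * (A * S.card * max r (1 / 2) ^ m * C ^ 2 +
        A * S.card * max r (1 / 2) ^ m * C ^ 2 +
        S.card * (4 * C ^ 2 * (K * max r (1 / 2) ^ m))) := by gcongr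
    _ = _ := by ring

/-- Elementary comparison of an exponentially small Chebyshev bound with the rate `L / log L`. -/
lemma exists_le_exp_of_le_geometric {p : ℕ → ℝ → ℝ} {C K r : ℝ} {M : ℕ} (hC : 0 < C) (hK : 0 < K)
    (hr0 : 0 < r) (hr1 : r < 1) (hM : 0 < M) (hp1 : ∀ L ε, p L ε ≤ 1)
    (hpC : ∀ L ε, C ≤ ε → p L ε ≤ 0)
    (hp : ∀ L ε, 1 ≤ L → 0 < ε → p L ε ≤ K * r ^ (L / M) / ε ^ 2) :
    ∃ c₁ c₂ : ℝ, 0 < c₁ ∧ 0 < c₂ ∧ ∀ L : ℕ, 2 ≤ L → ∀ ε : ℝ, 0 < ε →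
      p L ε ≤ c₁ * Real.exp (-(c₂ * ε * (L / Real.log L))) := by
  set γ := -Real.log r with hγdef
  have hγ : 0 < γ := neg_pos.2 (Real.log_neg hr0 hr1)
  have hM' : (0 : ℝ) < M := by exact_mod_cast hM
  -- The geometric bound decays like `exp(-2βL)`: one half absorbs the factor `L²` from `1/ε²`, the
  -- other gives the final rate.
  set β := γ / (2 * M) with hβdef
  have hβ : 0 < β := by positivity
  have hc₂ : 0 < min 1 (β / (2 * C)) := lt_min one_pos (by positivity)
  -- `exp 1` and the bound `1` on `c₂` serve the case `ε L / log L ≤ 1`; the other terms serve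
  -- larger `ε < C`, where `L / log L ≤ 2L` keeps the exponent within `βL`.
  refine ⟨Real.exp 1 + 8 * K * Real.exp γ / β ^ 2, min 1 (β / (2 * C)), by positivity, hc₂,
    fun L hL ε hε => ?_⟩
  set c₂ := min 1 (β / (2 * C)) with hc₂def
  rcases le_or_gt C ε with hCε | hεC
  · exact (hpC L ε hCε).trans (by positivity)
  have hL2 : (2 : ℝ) ≤ L := by exact_mod_cast hL
  have hlog : 1 / 2 ≤ Real.log L := by
    have h1 : Real.log 2 ≤ Real.log L := Real.log_le_log (by norm_num) hL2
    linarith [Real.log_two_gt_d9]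
  have hlog0 : 0 < Real.log L := by linarith
  have hquot : (L : ℝ) / Real.log L ≤ 2 * L := by
    rw [div_le_iff₀ hlog0]
    nlinarith
  have hquot0 : 0 < (L : ℝ) / Real.log L := by positivity
  rcases le_or_gt (ε * (L / Real.log L)) 1 with hx | hx
  · have h1 : c₂ * ε * (L / Real.log L) ≤ 1 := by
      rw [mul_assoc]
      exact mul_le_one₀ (min_le_left _ _) (by positivity) hx
    calc p L ε ≤ 1 := hp1 _ _
      _ ≤ Real.exp 1 * Real.exp (-(c₂ * ε * (L / Real.log L))) := by
        rw [← Real.exp_add, ← Real.exp_zero, Real.exp_le_exp]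
        simp only [Real.exp_zero]
        linarith
      _ ≤ _ := by
        gcongr
        exact le_add_of_nonneg_right (by positivity)
  · have hεinv : 1 ≤ ε * (2 * L) := hx.le.trans (by gcongr)
    have hrate : r ^ (L / M) ≤ Real.exp γ * Real.exp (-(2 * β * L)) := by
      have hrexp : r = Real.exp (-γ) := by rw [hγdef, neg_neg, Real.exp_log hr0]
      have hdiv : (L : ℝ) / M - 1 ≤ ((L / M : ℕ) : ℝ) := by
        have h1 : L < M * (L / M + 1) := Nat.lt_mul_div_succ L hM
        have h2 : (L : ℝ) < M * (((L / M : ℕ) : ℝ) + 1) := by exact_mod_cast h1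
        rw [sub_le_iff_le_add, div_le_iff₀ hM']
        linarith
      have h2β : 2 * β * L = γ * (L / M) := by
        rw [hβdef]
        field_simp
      conv_lhs => rw [hrexp]
      rw [← Real.exp_nat_mul, ← Real.exp_add, Real.exp_le_exp, h2β]
      nlinarith
    have hsq : (L : ℝ) ^ 2 * Real.exp (-(β * L)) ≤ 2 / β ^ 2 := by
      have h1 := Real.pow_div_factorial_le_exp (β * L) (by positivity) 2
      rw [Real.exp_neg, ← div_eq_mul_inv, div_le_div_iff₀ (Real.exp_pos _) (by positivity)]
      norm_num [Nat.factorial] at h1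
      linarith [mul_pow β (L : ℝ) 2]
    have hinv : 1 / ε ^ 2 ≤ 4 * (L : ℝ) ^ 2 := by
      rw [div_le_iff₀ (by positivity)]
      nlinarith
    have hlast : c₂ * ε * (L / Real.log L) ≤ β * L := by
      calc c₂ * ε * (L / Real.log L) ≤ β / (2 * C) * C * (2 * L) := by
            gcongr
            exact min_le_right _ _
        _ = β * L := by field_simp
    calc p L ε ≤ K * r ^ (L / M) * (1 / ε ^ 2) :=
          (hp L ε (by omega) hε).trans_eq (by ring)
      _ ≤ K * (Real.exp γ * Real.exp (-(2 * β * L))) * (4 * (L : ℝ) ^ 2) := by gcongr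
      _ = 4 * K * Real.exp γ * Real.exp (-(β * L)) * ((L : ℝ) ^ 2 * Real.exp (-(β * L))) := by
        rw [show -(2 * β * (L : ℝ)) = -(β * L) + -(β * L) by ring, Real.exp_add]
        ring
      _ ≤ 4 * K * Real.exp γ * Real.exp (-(β * L)) * (2 / β ^ 2) := by gcongr
      _ = 8 * K * Real.exp γ / β ^ 2 * Real.exp (-(β * L)) := by ring
      _ ≤ (Real.exp 1 + 8 * K * Real.exp γ / β ^ 2) *
          Real.exp (-(c₂ * ε * (L / Real.log L))) := by
        gcongr
        exact le_add_of_nonneg_left (by positivity)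

end ExpGraph

/-! ### Conclusion by Chebyshev's inequality -/

theorem corollary1 {Ω : Type*} [MeasurableSpace Ω] (μ : Measure Ω) [IsProbabilityMeasure μ]
    (A : ℕ) (hA : 2 ≤ A)
    (G : SimpleGraph (ExpGraph.Node A)) (hG : ExpGraph.IsExpGrowing A G)
    (Z : ExpGraph.Node A → Ω → ℝ) (hZ : ∀ v, Measurable (Z v))
    (hmean : ∀ v, ∫ ω, Z v ω ∂μ = 0)
    (C σ : ℝ) (hC : 0 < C) (hσ : 0 < σ)
    (hbound : ∀ v, eLpNorm (Z v) ⊤ μ ≤ ENNReal.ofReal C)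
    (hvar : ∀ v, variance (Z v) μ ≤ σ ^ 2)
    (hstrong : Tendsto (ExpGraph.alphaMixing μ G Z) atTop (𝓝 0))
    (hmix : ExpGraph.SummableMixing A (ExpGraph.alphaMixing μ G Z) ∨
      ExpGraph.SuperExponentialDecay (ExpGraph.alphaMixing μ G Z)) :
    ∃ c₁ c₂ : ℝ, 0 < c₁ ∧ 0 < c₂ ∧ ∀ L : ℕ, 2 ≤ L → ∀ ε : ℝ, 0 < ε →
      μ.real {ω | 1 / ((ExpGraph.firstGenerations A L).card : ℝ) *
          |∑ v ∈ ExpGraph.firstGenerations A L, Z v ω| > ε} ≤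
        c₁ * Real.exp (-(c₂ * ε * (L / Real.log L))) := by
  have hZC (v : ExpGraph.Node A) : ∀ᵐ ω ∂μ, |Z v ω| ≤ C := by
    have hv := hbound v
    rw [eLpNorm_exponent_top] at hv
    filter_upwards [ae_le_eLpNormEssSup (f := Z v) (μ := μ)] with ω hω
    have h := hω.trans hv
    rwa [Real.enorm_eq_ofReal_abs, ENNReal.ofReal_le_ofReal_iff hC.le] at h
  obtain ⟨K, r, M, hK, hr0, hr1, hM, hsq⟩ :=
    ExpGraph.exists_integral_sum_sq_le hA hG hZ hmean hC hZC hmix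
  refine ExpGraph.exists_le_exp_of_le_geometric hC hK hr0 hr1 hM (fun L ε => measureReal_le_one)
    (fun L ε hε => ?_) (fun L ε hL hε => ?_)
  -- The sample mean is almost surely at most `C` in absolute value; the strict inequality in the
  -- event makes it null even at `ε = C`.
  · refine le_of_eq ?_
    rw [measureReal_eq_zero_iff]
    refine measure_eq_zero_iff_ae_notMem.2 ?_
    have hall : ∀ᵐ ω ∂μ, ∀ v ∈ ExpGraph.firstGenerations A L, |Z v ω| ≤ C :=
      (Finset.eventually_all _).2 fun v _ => hZC v
    filter_upwards [hall] with ω hω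
    simp only [gt_iff_lt, not_lt]
    refine le_trans ?_ hε
    have h1 : |∑ v ∈ ExpGraph.firstGenerations A L, Z v ω| ≤
        (ExpGraph.firstGenerations A L).card * C := by
      refine (Finset.abs_sum_le_sum_abs _ _).trans ?_
      exact (Finset.sum_le_card_nsmul _ _ C hω).trans_eq (nsmul_eq_mul _ _)
    rw [one_div, inv_mul_eq_div]
    exact div_le_of_le_mul₀ (Nat.cast_nonneg _) hC.le (by linarith)
  · set S := ExpGraph.firstGenerations A L with hS
    have hN : (0 : ℝ) < S.card := by
      have h1 : A ^ (L - 1) ≤ S.card := ExpGraph.le_card_firstGenerations hA hL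
      have h2 : 0 < A ^ (L - 1) := by positivity
      exact_mod_cast h2.trans_le h1
    have hmem : MemLp (fun ω => ∑ v ∈ S, Z v ω) 2 μ := memLp_finsetSum S fun v _ =>
      (memLp_top_of_bound (hZ v).aestronglyMeasurable C (by simpa using hZC v)).mono_exponent le_top
    have hcheb := mul_meas_ge_le_integral_of_nonneg (μ := μ)
      (ae_of_all _ fun ω => sq_nonneg (∑ v ∈ S, Z v ω)) hmem.integrable_sq ((S.card * ε) ^ 2)
    have hsub : μ.real {ω | 1 / (S.card : ℝ) * |∑ v ∈ S, Z v ω| > ε} ≤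
        μ.real {ω | (S.card * ε) ^ 2 ≤ (∑ v ∈ S, Z v ω) ^ 2} := by
      refine measureReal_mono fun ω hω => ?_
      simp only [Set.mem_ofPred_eq, gt_iff_lt] at hω ⊢
      rw [one_div, inv_mul_eq_div, lt_div_iff₀ hN] at hω
      rw [← sq_abs (∑ v ∈ S, Z v ω)]
      exact pow_le_pow_left₀ (by positivity) (by linarith) 2
    have h2 := hcheb.trans (hsq L hL)
    rw [le_div_iff₀ (by positivity)]
    refine le_trans (mul_le_mul_of_nonneg_right hsub (by positivity)) ?_
    refine le_of_mul_le_mul_left ?_ (show (0 : ℝ) < (S.card : ℝ) ^ 2 by positivity)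
    refine le_trans (le_of_eq ?_) h2
    ring
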